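/- **Proposition (Moyal expansion).** Let $d\in\mathbb N$ and write points of phase space $\mathbb R^{d}\times\mathbb R^{d}$ as $x=(\boldsymbol r,\boldsymbol p)$. Let $\{A,B\}_{\rm PB}=\sum_i(\partial_{r_i}A\,\partial_{p_i}B-\partial_{p_i}A\,\partial_{r_i}B)$ be the Poisson bracket and let $\Lambda=\sum_i(\partial_{r_i}\otimes\partial_{p_i}-\partial_{p_i}\otimes\partial_{r_i})$ be the corresponding bidifferential operator; $\Lambda^m(A,B)$ denotes $\Lambda^m$ applied to $A\otimes B$ and restricted to the diagonal, so that $\Lambda^1(A,B)=\{A,B\}_{\rm PB}$. For a wavelength $\lambda>0$ put $ƛ=\lambda/2\pi$. For $H$ smooth with all derivatives of at most polynomial growth and $W$ a Schwartz function (both complex-valued, in particular real), the Moyal bracket is $$\{\{H,W\}\}=\frac{2}{ƛ}\sin\Big(\frac{ƛ}{2}\Lambda\Big)(H,W),\qquad \sin(t\Lambda)=\frac{e^{it\Lambda}-e^{-it\Lambda}}{2i},$$ $$e^{it\Lambda}(H,W)(x)=\int_{\mathbb R^{2d}}H(x-2\pi t\,J\zeta)\,\widehat W(\zeta)\,e^{2\pi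 i\langle\zeta,x\rangle}\,d\zeta,\qquad J(\zeta_r,\zeta_p)=(\zeta_p,-\zeta_r),\quad \widehat W(\zeta)=\int W(y)e^{-2\pi i\langle \zeta,y\rangle}dy .$$ A family $z\mapsto W(z,\cdot)$ of Schwartz functions satisfies the Wigner–Moyal equation at $(z,x)$ if $z'\mapsto W(z',x)$ is differentiable at $z$ with derivative $\{\{H,W(z,\cdot)\}\}(x)$. Fix such an $H$, a compact set $K\subset\mathbb R^{2d}$ and $\lambda_0>0$. Below, $\mathcal O(\lambda^{m})$ stands for a quantity bounded by $C\lambda^{m}q(W(z,\cdot))$, where the constant $C$ and the Schwartz seminorm $q$ (a maximum of finitely many of the standard ones) depend only on $d,H,K,\lambda_0$ (and on $N$ in (1)), and not on $\lambda\in(0,\lambda_0]$, on $W$, on $z$, or on $x\in K$. Whenever $\lambda\in(0,\lambda_0]$, $x\in K$ and $W$ satisfies the Wigner–Moyal equation with wavelength $\lambda$ at $(z,x)$, the following hold at $(z,x)$. 1. For every $N\in\mathbb N$, $$\frac{\partial W}{\partial z}=\sum_{n=0}^{N-1}\frac{(-1)^n}{(2n+1)!}\Big(\frac{ƛ}{2}\Big)^{2n}\Lambda^{2n+1}(H,W)+\mathcal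 O(\lambda^{2N}).$$ 2. In particular, $$\frac{\partial W}{\partial z}=\{H,W\}_{\rm PB}-\frac{ƛ^2}{24}\,T_3(H,W)+\mathcal O(\lambda^4),$$ where $$T_3(H,W)=\sum_{i,j,k}\big(H_{r_ir_jr_k}W_{p_ip_jp_k}-3H_{r_ir_jp_k}W_{p_ip_jr_k}+3H_{r_ip_jp_k}W_{p_ir_jr_k}-H_{p_ip_jp_k}W_{r_ir_jr_k}\big).$$ 3. If all third derivatives of $H$ involving at least one momentum variable vanish identically (for example $H=V(\boldsymbol r)+|\boldsymbol p|^2/2n_0$ with a constant $n_0>0$), then $$\frac{\partial W}{\partial z}=\{H,W\}_{\rm PB}-\frac{ƛ^2}{24}\sum_{i,j,k}\frac{\partial^3H}{\partial r_i\partial r_j\partial r_k}\frac{\partial^3W}{\partial p_i\partial p_j\partial p_k}+\mathcal O(\lambda^4).$$ -/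

import Mathlib

open scoped FourierTransform SchwartzMap

noncomputable section

namespace WignerMoyal

/-- Phase space `ℝ^d × ℝ^d`: the coordinate `x (Sum.inl i)` is the position `r_i`, the
coordinate `x (Sum.inr i)` is the momentum `p_i`. -/
abbrev PhaseSpace (d : ℕ) : Type := EuclideanSpace ℝ (Fin d ⊕ Fin d)

variable {d : ℕ}

/-- The partial derivative `∂A/∂r_i`. -/
def dr (i : Fin d) (A : PhaseSpace d → ℂ) : PhaseSpace d → ℂ :=
  fun x => lineDeriv ℝ A x (EuclideanSpace.single (Sum.inl i) 1)

/-- The partial derivative `∂A/∂p_i`. -/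
def dp (i : Fin d) (A : PhaseSpace d → ℂ) : PhaseSpace d → ℂ :=
  fun x => lineDeriv ℝ A x (EuclideanSpace.single (Sum.inr i) 1)

/-- The Poisson bracket `∂A/∂r · ∂B/∂p - ∂A/∂p · ∂B/∂r`. -/
def poissonBracket (A B : PhaseSpace d → ℂ) (x : PhaseSpace d) : ℂ :=
  ∑ i, (dr i A x * dp i B x - dp i A x * dr i B x)

/-- The `m`-th power `Λ^m` of the bidifferential Poisson operator
`Λ = ∂_r ⊗ ∂_p - ∂_p ⊗ ∂_r` (first factor acting on `A`, second factor on `B`), applied to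
the pair `(A, B)` and restricted to the diagonal. -/
def poissonPow : ℕ → (PhaseSpace d → ℂ) → (PhaseSpace d → ℂ) → PhaseSpace d → ℂ
  | 0, A, B, x => A x * B x
  | m + 1, A, B, x =>
      ∑ i, (poissonPow m (dr i A) (dp i B) x - poissonPow m (dp i A) (dr i B) x)

/-- The symplectic rotation `(ζ_r, ζ_p) ↦ (ζ_p, -ζ_r)`. -/
def symplecticJ (ζ : PhaseSpace d) : PhaseSpace d :=
  WithLp.toLp 2 (Sum.elim (fun i => ζ (Sum.inr i)) (fun i => -ζ (Sum.inl i)))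

/-- The plane wave `y ↦ exp (2πi ⟨a, y⟩)` on phase space. -/
def planeWave (a y : PhaseSpace d) : ℂ :=
  Complex.exp (2 * Real.pi * Complex.I * ((inner ℝ a y : ℝ) : ℂ))

/-- The exponential `exp (i t Λ)` of the bidifferential Poisson operator, applied to `(A, B)`
and restricted to the diagonal. Write `B` as the superposition of the plane waves
`exp (2πi ⟨ζ, y⟩)` with weights `𝓕 B ζ`. On `A ⊗ exp (2πi ⟨ζ, ·⟩)` the operator `i t Λ` acts as
the directional derivative of `A` along `-2πt J ζ`, so that its exponential is the translation
of `A` by that vector. -/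
def expPoisson (t : ℝ) (A B : PhaseSpace d → ℂ) (x : PhaseSpace d) : ℂ :=
  ∫ ζ : PhaseSpace d,
    A (x - (2 * Real.pi * t) • symplecticJ ζ) * (𝓕 B ζ * planeWave ζ x)

/-- The sine `sin (t Λ) = (exp (i t Λ) - exp (-i t Λ)) / (2 i)` of the bidifferential Poisson
operator, applied to `(A, B)` and restricted to the diagonal. -/
def sinPoisson (t : ℝ) (A B : PhaseSpace d → ℂ) (x : PhaseSpace d) : ℂ :=
  (expPoisson t A B x - expPoisson (-t) A B x) / (2 * Complex.I)

/-- The Moyal bracket `(2/ƛ) sin ((ƛ/2) Λ)` of `A` and `B`, where `bar` is the reduced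
wavelength `ƛ`. -/
def moyalBracket (bar : ℝ) (A B : PhaseSpace d → ℂ) (x : PhaseSpace d) : ℂ :=
  (2 / bar : ℝ) * sinPoisson (bar / 2) A B x

/-- The family `z ↦ W z` of phase space functions satisfies at `(z, x)` the Wigner-Moyal equation
`∂W/∂z = {{H, W}}` for the wavelength `lam`. -/
def WignerMoyalEquationAt (lam : ℝ) (H : PhaseSpace d → ℂ) (W : ℝ → 𝓢(PhaseSpace d, ℂ))
    (z : ℝ) (x : PhaseSpace d) : Prop :=
  HasDerivAt (fun z' => W z' x) (moyalBracket (lam / (2 * Real.pi)) H (W z) x) z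

/-- The third order contraction of the third derivatives of `A` and `B`. -/
def thirdOrder (A B : PhaseSpace d → ℂ) (x : PhaseSpace d) : ℂ :=
  ∑ i, ∑ j, ∑ k,
    (dr i (dr j (dr k A)) x * dp i (dp j (dp k B)) x
      - 3 * (dr i (dr j (dp k A)) x * dp i (dp j (dr k B)) x)
      + 3 * (dr i (dp j (dp k A)) x * dp i (dr j (dr k B)) x)
      - dp i (dp j (dp k A)) x * dr i (dr j (dr k B)) x)

/-- Consistency of `sinPoisson` with its name: on `exp (2πi ⟨a, ·⟩) ⊗ exp (2πi ⟨ζ, ·⟩)` the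
operator `Λ` has the eigenvalue `(2πi)² (a_r · ζ_p - a_p · ζ_r) = -4π² ⟨a, J ζ⟩`, and
`sin (t Λ)` has the sine of `t` times this eigenvalue. -/
theorem sinPoisson_planeWave (t : ℝ) (a : PhaseSpace d) (B : 𝓢(PhaseSpace d, ℂ))
    (x : PhaseSpace d) :
    sinPoisson t (planeWave a) B x = ∫ ζ : PhaseSpace d,
      Complex.sin (t * (-4 * Real.pi ^ 2 * inner ℝ a (symplecticJ ζ) : ℝ)) *
        (planeWave a x * (𝓕 (B : PhaseSpace d → ℂ) ζ * planeWave ζ x)) := by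
  have hc : ∀ a : PhaseSpace d, Continuous (planeWave a) := by
    intro a; unfold planeWave; fun_prop
  have hc' : Continuous fun ζ : PhaseSpace d => planeWave ζ x := by
    unfold planeWave; fun_prop
  have hJ : Continuous (symplecticJ (d := d)) := by
    unfold symplecticJ
    refine (PiLp.continuous_toLp 2 _).comp (continuous_pi ?_)
    rintro (i | i) <;> simp <;> fun_prop
  have hn : ∀ a y : PhaseSpace d, ‖planeWave a y‖ ≤ 1 := by
    intro a y
    unfold planeWave
    rw [Complex.norm_exp]
    simp
  have hF : MeasureTheory.Integrable (𝓕 (B : PhaseSpace d → ℂ)) := by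
    rw [← SchwartzMap.fourier_coe]
    exact (𝓕 B).integrable
  have hint : ∀ t : ℝ, MeasureTheory.Integrable fun ζ : PhaseSpace d =>
      planeWave a (x - (2 * Real.pi * t) • symplecticJ ζ) *
        (𝓕 (B : PhaseSpace d → ℂ) ζ * planeWave ζ x) := by
    intro t
    refine MeasureTheory.Integrable.bdd_mul (c := 1) ?_ ?_ ?_
    · exact hF.mul_bdd (c := 1) hc'.aestronglyMeasurable
        (Filter.Eventually.of_forall fun ζ => hn ζ x)
    · exact ((hc a).comp (by fun_prop)).aestronglyMeasurable
    · exact Filter.Eventually.of_forall fun ζ => hn _ _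
  unfold sinPoisson expPoisson
  rw [← MeasureTheory.integral_sub (hint t) (hint (-t)), ← MeasureTheory.integral_div]
  congr 1
  ext ζ
  have key : ∀ t : ℝ, planeWave a (x - (2 * Real.pi * t) • symplecticJ ζ) =
      Complex.exp ((t * (-4 * Real.pi ^ 2 * inner ℝ a (symplecticJ ζ) : ℝ)) * Complex.I)
        * planeWave a x := by
    intro t
    unfold planeWave
    rw [← Complex.exp_add, inner_sub_right, inner_smul_right]
    congr 1
    push_cast
    ring
  rw [key, key, Complex.sin]
  push_cast
  field_simp
  ring_nf
  simp [Complex.I_sq]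
  try ring

end WignerMoyal

end

/-! For fixed `ζ` restrict `H` to the line `t ↦ x - 2πt Jζ` (`alongLine`). Then `exp (itΛ)(H, W)(x)`
is the integral of this function of `t` against `𝓕 W ζ * planeWave ζ x`. Each `t`-derivative yields
factors `-2π (Jζ)_a` with `∂_a H`; as `2πi ζ_b` is the Fourier multiplier of `∂_b`, the `m`-th
derivative at `0` integrates to `i^m Λ^m(H, W)(x)` (`integral_iteratedDeriv_alongLine`).

The difference of the two exponentials keeps only odd Taylor terms. Its remainder is controlled by
the derivative of order `2N+1`, which grows polynomially in `ζ`, uniformly for `x ∈ K` and `|t| ≤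
lam₀` (`alongLine_iteratedDeriv_bound`); the weighted `L¹` norm of `𝓕 W` is bounded by a Schwartz
seminorm (`integral_one_add_norm_pow_mul_fourier_le`). Dividing by `2it`, `t = ƛ/2`, costs one power
and leaves `O(λ^(2N))`. The explicit `λ⁴` formulas are the case `N = 2`, with `Λ³` computed in
`poissonPow_three`. -/

namespace WignerMoyal

open MeasureTheory LineDeriv

variable {d : ℕ}

/-! ### Coordinate derivatives: symmetry, temperate growth, Fourier multipliers. -/

/-- The partial derivative of `A` with respect to the phase space coordinate `a`. -/
noncomputable def partialDeriv (a : Fin d ⊕ Fin d) (A : PhaseSpace d → ℂ) : PhaseSpace d → ℂ :=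
  fun x => lineDeriv ℝ A x (EuclideanSpace.single a 1)

theorem partialDeriv_inl (i : Fin d) (A : PhaseSpace d → ℂ) :
    partialDeriv (Sum.inl i) A = dr i A := rfl

theorem partialDeriv_inr (i : Fin d) (A : PhaseSpace d → ℂ) :
    partialDeriv (Sum.inr i) A = dp i A := rfl

theorem partialDeriv_eq_fderiv {A : PhaseSpace d → ℂ} (hA : Differentiable ℝ A)
    (a : Fin d ⊕ Fin d) :
    partialDeriv a A = fun x => fderiv ℝ A x (EuclideanSpace.single a 1) := by
  ext x
  exact (hA x).lineDeriv_eq_fderiv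

theorem partialDeriv_contDiff {A : PhaseSpace d → ℂ} (hA : ContDiff ℝ (⊤ : ℕ∞) A)
    (a : Fin d ⊕ Fin d) : ContDiff ℝ (⊤ : ℕ∞) (partialDeriv a A) := by
  rw [partialDeriv_eq_fderiv (hA.differentiable (by simp))]
  exact (hA.fderiv_right (by simp)).clm_apply contDiff_const

theorem partialDeriv_comm {A : PhaseSpace d → ℂ} (hA : ContDiff ℝ (⊤ : ℕ∞) A)
    (a b : Fin d ⊕ Fin d) :
    partialDeriv a (partialDeriv b A) = partialDeriv b (partialDeriv a A) := by
  have hd : Differentiable ℝ (fderiv ℝ A) :=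
    (hA.fderiv_right (m := (⊤ : ℕ∞)) (by simp)).differentiable (by simp)
  have key : ∀ (a b : Fin d ⊕ Fin d) (x : PhaseSpace d),
      partialDeriv a (partialDeriv b A) x =
        fderiv ℝ (fderiv ℝ A) x (EuclideanSpace.single a 1) (EuclideanSpace.single b 1) := by
    intro a b x
    rw [partialDeriv_eq_fderiv ((partialDeriv_contDiff hA b).differentiable (by simp)),
      partialDeriv_eq_fderiv (hA.differentiable (by simp))]
    change fderiv ℝ (fun y => fderiv ℝ A y (EuclideanSpace.single b 1)) x _ = _
    rw [fderiv_clm_apply (hd x) (differentiableAt_const _)]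
    simp
  ext x
  rw [key, key]
  exact (hA.contDiffAt.isSymmSndFDerivAt (by simp; exact WithTop.coe_le_coe.2 le_top)).eq _ _

theorem hasTemperateGrowth_fderiv {E F : Type*} [NormedAddCommGroup E] [NormedSpace ℝ E]
    [NormedAddCommGroup F] [NormedSpace ℝ F] {f : E → F} (hf : f.HasTemperateGrowth) :
    (fderiv ℝ f).HasTemperateGrowth := by
  refine ⟨hf.1.fderiv_right (by simp), fun n => ?_⟩
  obtain ⟨k, C, h⟩ := hf.2 (n + 1)
  exact ⟨k, C, fun x => by rw [norm_iteratedFDeriv_fderiv]; exact h x⟩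

theorem partialDeriv_hasTemperateGrowth {A : PhaseSpace d → ℂ} (hA : A.HasTemperateGrowth)
    (a : Fin d ⊕ Fin d) : (partialDeriv a A).HasTemperateGrowth := by
  rw [partialDeriv_eq_fderiv (hA.1.differentiable (by simp))]
  exact (ContinuousLinearMap.apply ℝ ℂ
    (EuclideanSpace.single a (1 : ℝ))).hasTemperateGrowth.comp (hasTemperateGrowth_fderiv hA)

theorem coe_lineDerivOp_single (a : Fin d ⊕ Fin d) (B : 𝓢(PhaseSpace d, ℂ)) :
    (∂_{(EuclideanSpace.single a (1 : ℝ) : PhaseSpace d)} B : 𝓢(PhaseSpace d, ℂ)) =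
      partialDeriv a (B : PhaseSpace d → ℂ) := by
  ext x
  exact SchwartzMap.lineDerivOp_apply _ _ _

theorem fourier_partialDeriv (a : Fin d ⊕ Fin d) (B : 𝓢(PhaseSpace d, ℂ)) (ζ : PhaseSpace d) :
    𝓕 (partialDeriv a (B : PhaseSpace d → ℂ)) ζ =
      2 * Real.pi * Complex.I * (ζ a : ℂ) * 𝓕 (B : PhaseSpace d → ℂ) ζ := by
  have h := DFunLike.congr_fun (SchwartzMap.fourier_lineDerivOp_eq B (EuclideanSpace.single a 1)) ζ
  have ht : (fun y : PhaseSpace d =>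
      inner ℝ y (EuclideanSpace.single a (1 : ℝ))).HasTemperateGrowth := by fun_prop
  rw [SchwartzMap.fourier_coe, coe_lineDerivOp_single] at h
  rw [h, smul_apply, SchwartzMap.smulLeftCLM_apply_apply ht, SchwartzMap.fourier_coe]
  simp [EuclideanSpace.inner_single_right, mul_assoc]

/-! ### Fourier inversion and weighted `L¹` bounds on the Fourier transform. -/

theorem planeWave_norm (a y : PhaseSpace d) : ‖planeWave a y‖ = 1 := by
  unfold planeWave
  rw [Complex.norm_exp]
  simp

theorem planeWave_continuous_left (y : PhaseSpace d) :
    Continuous fun a : PhaseSpace d => planeWave a y := by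
  unfold planeWave; fun_prop

theorem integral_fourier_mul_planeWave (B : 𝓢(PhaseSpace d, ℂ)) (x : PhaseSpace d) :
    ∫ ζ, 𝓕 (B : PhaseSpace d → ℂ) ζ * planeWave ζ x = B x := by
  have h : 𝓕⁻ (𝓕 B) x = B x := by rw [FourierTransform.fourierInv_fourier_eq]
  rw [SchwartzMap.fourierInv_coe, Real.fourierInv_eq'] at h
  rw [← h]
  congr 1
  ext ζ
  rw [smul_eq_mul, mul_comm, SchwartzMap.fourier_coe]
  congr 1
  unfold planeWave
  congr 1
  push_cast
  ring

theorem exists_integral_pow_mul_norm_le :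
    ∃ (M : ℝ) (l : ℕ), 0 ≤ M ∧ ∀ (f : 𝓢(PhaseSpace d, ℂ)) (m : ℕ),
      ∫ ζ, ‖ζ‖ ^ m * ‖f ζ‖ ≤
        M * (SchwartzMap.seminorm ℝ 0 0 f + SchwartzMap.seminorm ℝ (m + l) 0 f) := by
  refine ⟨2 ^ (volume : Measure (PhaseSpace d)).integrablePower *
      (∫ x : PhaseSpace d,
        (1 + ‖x‖) ^ (-((volume : Measure (PhaseSpace d)).integrablePower : ℝ))),
    (volume : Measure (PhaseSpace d)).integrablePower, by positivity, fun f m => ?_⟩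
  have h := SchwartzMap.integral_pow_mul_iteratedFDeriv_le ℝ volume f m 0
  simp only [norm_iteratedFDeriv_zero] at h
  exact h

theorem integral_one_add_norm_pow_mul_le (f : 𝓢(PhaseSpace d, ℂ)) (k : ℕ) :
    Integrable (fun ζ => (1 + ‖ζ‖) ^ k * ‖f ζ‖) ∧
    ∫ ζ, (1 + ‖ζ‖) ^ k * ‖f ζ‖ ≤
      2 ^ (k - 1) * ((∫ ζ, ‖ζ‖ ^ 0 * ‖f ζ‖) + ∫ ζ, ‖ζ‖ ^ k * ‖f ζ‖) := by
  have hi : ∀ m : ℕ, Integrable (fun ζ => ‖ζ‖ ^ m * ‖f ζ‖) := f.integrable_pow_mul volume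
  have hpt : ∀ ζ : PhaseSpace d, (1 + ‖ζ‖) ^ k * ‖f ζ‖ ≤
      2 ^ (k - 1) * (‖ζ‖ ^ 0 * ‖f ζ‖ + ‖ζ‖ ^ k * ‖f ζ‖) := fun ζ => by
    have := add_pow_le (zero_le_one (α := ℝ)) (norm_nonneg ζ) k
    calc _ ≤ (2 ^ (k - 1) * (1 ^ k + ‖ζ‖ ^ k)) * ‖f ζ‖ := by gcongr
      _ = _ := by rw [one_pow, pow_zero]; ring
  have hdom : Integrable (fun ζ => 2 ^ (k - 1) *
      (‖ζ‖ ^ 0 * ‖f ζ‖ + ‖ζ‖ ^ k * ‖f ζ‖)) := ((hi 0).add (hi k)).const_mul _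
  have hint : Integrable (fun ζ => (1 + ‖ζ‖) ^ k * ‖f ζ‖) := by
    refine hdom.mono' ?_ (Filter.Eventually.of_forall fun ζ => ?_)
    · exact Continuous.aestronglyMeasurable
        (((continuous_const.add continuous_norm).pow k).mul f.continuous.norm)
    · rw [Real.norm_of_nonneg (by positivity)]
      exact hpt ζ
  refine ⟨hint, (integral_mono hint hdom hpt).trans_eq ?_⟩
  rw [integral_const_mul, integral_add (hi 0) (hi k)]

/-- The Fourier transform is continuous on Schwartz space, so the pullback of a continuous seminorm
is dominated by finitely many standard ones. The summands are those arising from the moments of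
order `0` and `k`. -/
theorem fourier_seminorm_le (l k : ℕ) :
    ∃ (C : ℝ) (s : Finset (ℕ × ℕ)), 0 ≤ C ∧ ∀ B : 𝓢(PhaseSpace d, ℂ),
      SchwartzMap.seminorm ℝ 0 0 (𝓕 B) + SchwartzMap.seminorm ℝ l 0 (𝓕 B) +
        (SchwartzMap.seminorm ℝ 0 0 (𝓕 B) + SchwartzMap.seminorm ℝ k 0 (𝓕 B)) ≤
        C * s.sup (schwartzSeminormFamily ℝ (PhaseSpace d) ℂ) B := by
  have hs : ∀ m n, Continuous (SchwartzMap.seminorm ℝ m n : Seminorm ℝ 𝓢(PhaseSpace d, ℂ)) :=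
    fun m n => (schwartz_withSeminorms ℝ (PhaseSpace d) ℂ).continuous_seminorm (m, n)
  obtain ⟨s, C, -, hC⟩ := Seminorm.bound_of_continuous
    (schwartz_withSeminorms ℝ (PhaseSpace d) ℂ)
    ((SchwartzMap.seminorm ℝ 0 0 + SchwartzMap.seminorm ℝ l 0 +
      (SchwartzMap.seminorm ℝ 0 0 + SchwartzMap.seminorm ℝ k 0)).comp
      ((FourierTransform.fourierCLM ℝ 𝓢(PhaseSpace d, ℂ)).toLinearMap))
    ((((hs 0 0).add (hs l 0)).add ((hs 0 0).add (hs k 0))).comp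
      (FourierTransform.fourierCLM ℝ 𝓢(PhaseSpace d, ℂ)).continuous)
  exact ⟨C, s, C.2, fun B => hC B⟩

/-- Integrals of the Fourier transform against a polynomial weight are bounded by a Schwartz
seminorm. -/
theorem integral_one_add_norm_pow_mul_fourier_le (k : ℕ) :
    ∃ (C : ℝ) (s : Finset (ℕ × ℕ)), 0 ≤ C ∧ ∀ B : 𝓢(PhaseSpace d, ℂ),
      Integrable (fun ζ => (1 + ‖ζ‖) ^ k * ‖𝓕 (B : PhaseSpace d → ℂ) ζ‖) ∧
      ∫ ζ, (1 + ‖ζ‖) ^ k * ‖𝓕 (B : PhaseSpace d → ℂ) ζ‖ ≤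
        C * s.sup (schwartzSeminormFamily ℝ (PhaseSpace d) ℂ) B := by
  obtain ⟨M, l, hM0, hM⟩ := exists_integral_pow_mul_norm_le (d := d)
  obtain ⟨C, s, hC0, hC⟩ := fourier_seminorm_le (d := d) (0 + l) (k + l)
  refine ⟨2 ^ (k - 1) * (M * C), s, by positivity, fun B => ?_⟩
  obtain ⟨hint, hle⟩ := integral_one_add_norm_pow_mul_le (𝓕 B) k
  refine ⟨hint, hle.trans ?_⟩
  rw [mul_assoc, mul_assoc]
  refine mul_le_mul_of_nonneg_left ?_ (by positivity)
  refine (add_le_add (hM (𝓕 B) 0) (hM (𝓕 B) k)).trans ?_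
  rw [← mul_add]
  exact mul_le_mul_of_nonneg_left (hC B) hM0

/-! ### Restriction of a symbol to the lines in direction `Jζ`. -/

theorem symplecticJ_inl (ζ : PhaseSpace d) (i : Fin d) :
    symplecticJ ζ (Sum.inl i) = ζ (Sum.inr i) := rfl

theorem symplecticJ_inr (ζ : PhaseSpace d) (i : Fin d) :
    symplecticJ ζ (Sum.inr i) = -ζ (Sum.inl i) := rfl

theorem abs_symplecticJ_apply_le (ζ : PhaseSpace d) (a : Fin d ⊕ Fin d) :
    |symplecticJ ζ a| ≤ ‖ζ‖ := by
  rcases a with i | i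
  · rw [symplecticJ_inl, ← Real.norm_eq_abs]
    exact PiLp.norm_apply_le ζ _
  · rw [symplecticJ_inr, abs_neg, ← Real.norm_eq_abs]
    exact PiLp.norm_apply_le ζ _

theorem symplecticJ_norm (ζ : PhaseSpace d) : ‖symplecticJ ζ‖ = ‖ζ‖ := by
  rw [EuclideanSpace.norm_eq, EuclideanSpace.norm_eq]
  simp only [Fintype.sum_sum_type, symplecticJ_inl, symplecticJ_inr, norm_neg]
  rw [add_comm]

theorem symplecticJ_continuous : Continuous (symplecticJ (d := d)) := by
  unfold symplecticJ
  refine (PiLp.continuous_toLp 2 _).comp (continuous_pi ?_)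
  rintro (i | i) <;> simp <;> fun_prop

/-- The function `A` along the line through `x` in the direction `-2π J ζ`. -/
noncomputable def alongLine (A : PhaseSpace d → ℂ) (x ζ : PhaseSpace d) (t : ℝ) : ℂ :=
  A (x - (2 * Real.pi * t) • symplecticJ ζ)

theorem alongLine_contDiff {A : PhaseSpace d → ℂ} (hA : ContDiff ℝ (⊤ : ℕ∞) A)
    (x ζ : PhaseSpace d) : ContDiff ℝ (⊤ : ℕ∞) (alongLine A x ζ) :=
  hA.comp (contDiff_const.sub ((contDiff_const.mul contDiff_id).smul contDiff_const))

theorem alongLine_deriv {A : PhaseSpace d → ℂ} (hA : ContDiff ℝ (⊤ : ℕ∞) A)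
    (x ζ : PhaseSpace d) :
    deriv (alongLine A x ζ) = fun t => ∑ a, ((-(2 * Real.pi * symplecticJ ζ a) : ℝ) : ℂ) *
      alongLine (partialDeriv a A) x ζ t := by
  have hd : Differentiable ℝ A := hA.differentiable (by simp)
  ext t
  have h1 : HasDerivAt (fun t : ℝ => x - (2 * Real.pi * t) • symplecticJ ζ)
      (-((2 * Real.pi) • symplecticJ ζ)) t := by
    simpa using (((hasDerivAt_id t).const_mul (2 * Real.pi)).smul_const
      (symplecticJ ζ)).const_sub x
  have h2 : HasDerivAt (alongLine A x ζ) (fderiv ℝ A (x - (2 * Real.pi * t) • symplecticJ ζ)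
      (-((2 * Real.pi) • symplecticJ ζ))) t := (hd _).hasFDerivAt.comp_hasDerivAt t h1
  have h3 : -((2 * Real.pi) • symplecticJ ζ) =
      ∑ a, (-(2 * Real.pi * symplecticJ ζ a)) • EuclideanSpace.single a (1 : ℝ) := by
    ext b
    rcases b with i | i <;> simp [Finset.sum_apply, Pi.single_apply]
  rw [h2.deriv, h3, map_sum]
  refine Finset.sum_congr rfl fun a _ => ?_
  rw [map_smul, partialDeriv_eq_fderiv hd, Complex.real_smul]
  rfl

/-- Peeling off the innermost derivative replaces `A` by its partials, the same recursion as in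
`poissonPow`; hence the inductions on `m` below generalize over `A`. -/
theorem alongLine_iteratedDeriv_succ {A : PhaseSpace d → ℂ} (hA : ContDiff ℝ (⊤ : ℕ∞) A)
    (x ζ : PhaseSpace d) (m : ℕ) (t : ℝ) :
    iteratedDeriv (m + 1) (alongLine A x ζ) t =
      ∑ a, ((-(2 * Real.pi * symplecticJ ζ a) : ℝ) : ℂ) *
        iteratedDeriv m (alongLine (partialDeriv a A) x ζ) t := by
  have hc : ∀ a, ContDiff ℝ m (alongLine (partialDeriv a A) x ζ) := fun a =>
    (alongLine_contDiff (partialDeriv_contDiff hA a) x ζ).of_le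
      (by exact WithTop.coe_le_coe.2 le_top)
  rw [iteratedDeriv_succ', alongLine_deriv hA, iteratedDeriv_fun_sum]
  · refine Finset.sum_congr rfl fun a _ => ?_
    rw [iteratedDeriv_const_mul _ (hc a).contDiffAt]
  · intro a _
    exact (contDiff_const.mul (hc a)).contDiffAt

theorem alongLine_iteratedDeriv_continuous {A : PhaseSpace d → ℂ} (hA : ContDiff ℝ (⊤ : ℕ∞) A)
    (x : PhaseSpace d) (m : ℕ) (t : ℝ) :
    Continuous fun ζ => iteratedDeriv m (alongLine A x ζ) t := by
  induction m generalizing A with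
  | zero =>
    simp only [iteratedDeriv_zero]
    have hJ := symplecticJ_continuous (d := d)
    exact hA.continuous.comp (by fun_prop)
  | succ m ih =>
    simp only [alongLine_iteratedDeriv_succ hA]
    refine continuous_finsetSum _ fun a _ => ?_
    refine (Complex.continuous_ofReal.comp ?_).mul (ih (partialDeriv_contDiff hA a))
    exact (continuous_const.mul ((EuclideanSpace.proj a).continuous.comp
      symplecticJ_continuous)).neg

theorem alongLine_iteratedDeriv_bound {A : PhaseSpace d → ℂ} (hA : A.HasTemperateGrowth)
    (m : ℕ) {R T : ℝ} (hR : 0 ≤ R) (hT : 0 ≤ T) :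
    ∃ (C : ℝ) (k : ℕ), 0 ≤ C ∧ ∀ x : PhaseSpace d, ‖x‖ ≤ R → ∀ (ζ : PhaseSpace d) (t : ℝ),
      |t| ≤ T → ‖iteratedDeriv m (alongLine A x ζ) t‖ ≤ C * (1 + ‖ζ‖) ^ k := by
  induction m generalizing A with
  | zero =>
    obtain ⟨k, C, hC0, hC⟩ := hA.norm_iteratedFDeriv_le_uniform 0
    -- Since `J` is an isometry, the point on the line has norm at most `R + 2πT‖ζ‖`, and `1 + R +
    -- 2πT‖ζ‖ ≤ (1 + R + 2πT)(1 + ‖ζ‖)`.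
    refine ⟨C * (1 + R + 2 * Real.pi * T) ^ k, k, by positivity, fun x hx ζ t ht => ?_⟩
    have h := hC 0 le_rfl (x - (2 * Real.pi * t) • symplecticJ ζ)
    rw [norm_iteratedFDeriv_zero] at h
    rw [iteratedDeriv_zero]
    refine h.trans ?_
    rw [mul_assoc C, ← mul_pow]
    gcongr
    have h1 : ‖x - (2 * Real.pi * t) • symplecticJ ζ‖ ≤ R + 2 * Real.pi * T * ‖ζ‖ := by
      refine (norm_sub_le _ _).trans ?_
      rw [norm_smul, symplecticJ_norm, norm_mul, norm_mul, Real.norm_eq_abs t,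
        Real.norm_of_nonneg Real.pi_pos.le, Real.norm_of_nonneg (zero_le_two)]
      gcongr
    have h2 : 0 ≤ R * ‖ζ‖ := by positivity
    have h3 : 0 ≤ 2 * Real.pi * T := by positivity
    have h4 := norm_nonneg ζ
    nlinarith
  | succ m ih =>
    choose C k hC0 hC using fun a => ih (partialDeriv_hasTemperateGrowth hA a)
    -- The sum of the exponents serves as their common upper bound; the extra `1` pays for the
    -- factor `(Jζ)_a`.
    refine ⟨∑ a, 2 * Real.pi * C a, ∑ a, k a + 1,
      Finset.sum_nonneg fun a _ => mul_nonneg (by positivity) (hC0 a), fun x hx ζ t ht => ?_⟩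
    rw [alongLine_iteratedDeriv_succ hA.1, Finset.sum_mul]
    refine norm_sum_le_of_le _ fun a _ => ?_
    have h1 : (1 : ℝ) ≤ 1 + ‖ζ‖ := by simp
    have hCa := hC0 a
    rw [norm_mul, Complex.norm_real, norm_neg, norm_mul, norm_mul,
      Real.norm_eq_abs (symplecticJ ζ a), Real.norm_of_nonneg Real.pi_pos.le, Real.norm_of_nonneg (zero_le_two)]
    calc 2 * Real.pi * |symplecticJ ζ a| *
          ‖iteratedDeriv m (alongLine (partialDeriv a A) x ζ) t‖
        ≤ 2 * Real.pi * (1 + ‖ζ‖) * (C a * (1 + ‖ζ‖) ^ k a) := by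
          gcongr
          · exact (abs_symplecticJ_apply_le ζ a).trans (by simp)
          · exact hC a x hx ζ t ht
      _ = 2 * Real.pi * C a * (1 + ‖ζ‖) ^ (k a + 1) := by ring
      _ ≤ 2 * Real.pi * C a * (1 + ‖ζ‖) ^ (∑ a, k a + 1) := by
          gcongr
          exact Finset.single_le_sum (fun _ _ => Nat.zero_le _) (Finset.mem_univ a)

theorem alongLine_iteratedDeriv_integrable {A : PhaseSpace d → ℂ} (hA : A.HasTemperateGrowth)
    (B : 𝓢(PhaseSpace d, ℂ)) (x : PhaseSpace d) (m : ℕ) (t : ℝ) :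
    Integrable fun ζ => iteratedDeriv m (alongLine A x ζ) t *
      (𝓕 (B : PhaseSpace d → ℂ) ζ * planeWave ζ x) := by
  obtain ⟨C, k, -, hC⟩ := alongLine_iteratedDeriv_bound hA m (norm_nonneg x) (abs_nonneg t)
  obtain ⟨_, _, _, hB⟩ := integral_one_add_norm_pow_mul_fourier_le (d := d) k
  refine ((hB B).1.const_mul C).mono' ?_ (Filter.Eventually.of_forall fun ζ => ?_)
  · exact ((alongLine_iteratedDeriv_continuous hA.1 x m t).mul
      ((𝓕 B).continuous.mul (planeWave_continuous_left x))).aestronglyMeasurable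
  · rw [norm_mul, norm_mul, planeWave_norm, mul_one, ← mul_assoc]
    gcongr
    exact hC x le_rfl ζ t le_rfl

/-- The `m`-th derivative at `t = 0` of `exp (i t Λ)` is `i ^ m Λ ^ m`. -/
theorem integral_iteratedDeriv_alongLine {A : PhaseSpace d → ℂ} (hA : A.HasTemperateGrowth)
    (B : 𝓢(PhaseSpace d, ℂ)) (x : PhaseSpace d) (m : ℕ) :
    ∫ ζ, iteratedDeriv m (alongLine A x ζ) 0 *
      (𝓕 (B : PhaseSpace d → ℂ) ζ * planeWave ζ x) = Complex.I ^ m * poissonPow m A B x := by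
  induction m generalizing A B with
  | zero =>
    simp only [iteratedDeriv_zero, alongLine, mul_zero, zero_smul, sub_zero]
    rw [integral_const_mul, integral_fourier_mul_planeWave]
    simp [poissonPow]
  | succ m ih =>
    have hpow : ∀ (a b : Fin d ⊕ Fin d),
        Integrable (fun ζ => iteratedDeriv m (alongLine (partialDeriv a A) x ζ) 0 *
          (𝓕 (partialDeriv b (B : PhaseSpace d → ℂ)) ζ * planeWave ζ x)) ∧
        ∫ ζ, iteratedDeriv m (alongLine (partialDeriv a A) x ζ) 0 *
          (𝓕 (partialDeriv b (B : PhaseSpace d → ℂ)) ζ * planeWave ζ x) =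
        Complex.I ^ m * poissonPow m (partialDeriv a A) (partialDeriv b B) x := by
      intro a b
      rw [← coe_lineDerivOp_single b B]
      exact ⟨alongLine_iteratedDeriv_integrable (partialDeriv_hasTemperateGrowth hA a) _ x m 0,
        ih (partialDeriv_hasTemperateGrowth hA a) _⟩
    have hpt : ∀ ζ, iteratedDeriv (m + 1) (alongLine A x ζ) 0 *
        (𝓕 (B : PhaseSpace d → ℂ) ζ * planeWave ζ x) =
        ∑ i, Complex.I * (iteratedDeriv m (alongLine (partialDeriv (Sum.inl i) A) x ζ) 0 *
            (𝓕 (partialDeriv (Sum.inr i) (B : PhaseSpace d → ℂ)) ζ * planeWave ζ x) -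
          iteratedDeriv m (alongLine (partialDeriv (Sum.inr i) A) x ζ) 0 *
            (𝓕 (partialDeriv (Sum.inl i) (B : PhaseSpace d → ℂ)) ζ * planeWave ζ x)) := by
      intro ζ
      rw [alongLine_iteratedDeriv_succ hA.1, Fintype.sum_sum_type, ← Finset.sum_add_distrib,
        Finset.sum_mul]
      refine Finset.sum_congr rfl fun i _ => ?_
      rw [fourier_partialDeriv, fourier_partialDeriv, symplecticJ_inl, symplecticJ_inr]
      push_cast
      -- The identity is `-2π = i · 2πi`; the sign in the momentum half of `J` supplies the minus
      -- sign of the Poisson bracket.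
      linear_combination (-(2 * Real.pi * (𝓕 (B : PhaseSpace d → ℂ) ζ * planeWave ζ x)) *
        (ζ (Sum.inr i) * iteratedDeriv m (alongLine (partialDeriv (Sum.inl i) A) x ζ) 0
          - ζ (Sum.inl i) * iteratedDeriv m (alongLine (partialDeriv (Sum.inr i) A) x ζ) 0)) *
          Complex.I_sq
    simp only [hpt]
    rw [integral_finsetSum]
    swap
    · exact fun i _ => ((hpow _ _).1.sub (hpow _ _).1).const_mul Complex.I
    rw [poissonPow, Finset.mul_sum]
    refine Finset.sum_congr rfl fun i _ => ?_
    rw [integral_const_mul, integral_sub (hpow _ _).1 (hpow _ _).1, (hpow _ _).2, (hpow _ _).2]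
    simp only [partialDeriv_inl, partialDeriv_inr]
    ring

/-! ### Taylor remainder of the odd part of a function of one variable. -/

/-- The derivative bound is asked on `|s| ≤ t`, not only on `[0, t]`, so that one hypothesis serves
both `f` and `s ↦ f (-s)`. The factor `1/n!` is given up. -/
theorem norm_sub_taylor_le {f : ℝ → ℂ} (hf : ContDiff ℝ (⊤ : ℕ∞) f) (n : ℕ) {C t : ℝ}
    (ht : 0 < t) (hC : ∀ s, |s| ≤ t → ‖iteratedDeriv (n + 1) f s‖ ≤ C) :
    ‖f t - ∑ k ∈ Finset.range (n + 1), ((t ^ k / k.factorial : ℝ) : ℂ) * iteratedDeriv k f 0‖ ≤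
      C * t ^ (n + 1) := by
  have hf' : ∀ m : ℕ, ContDiff ℝ m f := fun m => hf.of_le (by exact WithTop.coe_le_coe.2 le_top)
  have hw : ∀ (m : ℕ), ∀ s ∈ Set.Icc 0 t,
      iteratedDerivWithin m f (Set.Icc 0 t) s = iteratedDeriv m f s := fun m s hs =>
    iteratedDerivWithin_eq_iteratedDeriv (uniqueDiffOn_Icc ht) (hf' m).contDiffAt hs
  have h := taylor_mean_remainder_bound (f := f) (a := 0) (b := t) (x := t) (C := C) (n := n)
    ht.le (hf' (n + 1)).contDiffOn ⟨ht.le, le_rfl⟩ (fun y hy => by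
      rw [hw _ y hy]
      exact hC y (abs_le.2 ⟨by linarith [hy.1], hy.2⟩))
  rw [taylor_within_apply, sub_zero] at h
  have hC0 : 0 ≤ C := (norm_nonneg _).trans (hC 0 (by simpa using ht.le))
  have hsum : ∑ k ∈ Finset.range (n + 1), ((k.factorial : ℝ)⁻¹ * t ^ k) •
      iteratedDerivWithin k f (Set.Icc 0 t) 0 =
      ∑ k ∈ Finset.range (n + 1), ((t ^ k / k.factorial : ℝ) : ℂ) * iteratedDeriv k f 0 := by
    refine Finset.sum_congr rfl fun k _ => ?_
    rw [hw k 0 ⟨le_rfl, ht.le⟩, Complex.real_smul, inv_mul_eq_div]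
  rw [hsum] at h
  exact h.trans (div_le_self (by positivity) (by exact_mod_cast n.factorial_pos))

theorem sum_range_odd_part (a : ℕ → ℂ) (N : ℕ) :
    ∑ k ∈ Finset.range (2 * N + 1), a k - ∑ k ∈ Finset.range (2 * N + 1), (-1) ^ k * a k =
      2 * ∑ n ∈ Finset.range N, a (2 * n + 1) := by
  induction N with
  | zero => simp
  | succ N ih =>
    have h1 : (-1 : ℂ) ^ (2 * N + 1) = -1 := by simp [pow_succ]
    have h2 : (-1 : ℂ) ^ (2 * N + 1 + 1) = 1 := by simp [pow_succ]
    rw [show 2 * (N + 1) + 1 = 2 * N + 1 + 1 + 1 by ring, Finset.sum_range_succ,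
      Finset.sum_range_succ, Finset.sum_range_succ _ (2 * N + 1 + 1),
      Finset.sum_range_succ _ (2 * N + 1), Finset.sum_range_succ _ N, mul_add, ← ih, h1, h2]
    ring

/-- Taylor polynomials of even degree `2N` for `f` and its reflection are subtracted: even terms
cancel, while both remainders have order `2N+1`. -/
theorem norm_odd_part_sub_taylor_le {f : ℝ → ℂ} (hf : ContDiff ℝ (⊤ : ℕ∞) f) (N : ℕ) {C t : ℝ}
    (ht : 0 < t) (hC : ∀ s, |s| ≤ t → ‖iteratedDeriv (2 * N + 1) f s‖ ≤ C) :
    ‖f t - f (-t) - 2 * ∑ n ∈ Finset.range N,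
      ((t ^ (2 * n + 1) / (2 * n + 1).factorial : ℝ) : ℂ) * iteratedDeriv (2 * n + 1) f 0‖ ≤
      2 * C * t ^ (2 * N + 1) := by
  have h1 := norm_sub_taylor_le hf (2 * N) ht hC
  have h2 := norm_sub_taylor_le (f := fun s => f (-s)) (hf.comp contDiff_neg) (2 * N) ht
    (C := C) (fun s hs => by
      rw [iteratedDeriv_comp_neg, norm_smul, norm_pow, norm_neg, norm_one, one_pow, one_mul]
      exact hC (-s) (by rwa [abs_neg]))
  have h3 : ∑ k ∈ Finset.range (2 * N + 1), ((t ^ k / k.factorial : ℝ) : ℂ) *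
      iteratedDeriv k (fun s => f (-s)) 0 = ∑ k ∈ Finset.range (2 * N + 1), (-1) ^ k *
        (((t ^ k / k.factorial : ℝ) : ℂ) * iteratedDeriv k f 0) := by
    refine Finset.sum_congr rfl fun k _ => ?_
    rw [iteratedDeriv_comp_neg, neg_zero, Complex.real_smul]
    push_cast
    ring
  rw [h3] at h2
  rw [← sum_range_odd_part (fun k => ((t ^ k / k.factorial : ℝ) : ℂ) * iteratedDeriv k f 0) N]
  calc _ = ‖(f t - ∑ k ∈ Finset.range (2 * N + 1),
          ((t ^ k / k.factorial : ℝ) : ℂ) * iteratedDeriv k f 0) -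
        (f (-t) - ∑ k ∈ Finset.range (2 * N + 1), (-1) ^ k *
          (((t ^ k / k.factorial : ℝ) : ℂ) * iteratedDeriv k f 0))‖ := by
        congr 1; ring
    _ ≤ C * t ^ (2 * N + 1) + C * t ^ (2 * N + 1) := (norm_sub_le _ _).trans (add_le_add h1 h2)
    _ = _ := by ring

/-! ### Expansion of the Moyal bracket with uniform remainder. -/

/-- With everything under one integral, the Taylor remainder can be estimated pointwise in `ζ`. -/
theorem expPoisson_sub_expPoisson_neg {A : PhaseSpace d → ℂ} (hA : A.HasTemperateGrowth)
    (B : 𝓢(PhaseSpace d, ℂ)) (x : PhaseSpace d) (N : ℕ) (t : ℝ) :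
    expPoisson t A B x - expPoisson (-t) A B x - 2 * ∑ n ∈ Finset.range N,
      ((t ^ (2 * n + 1) / (2 * n + 1).factorial : ℝ) : ℂ) *
        (Complex.I ^ (2 * n + 1) * poissonPow (2 * n + 1) A B x) =
    ∫ ζ, (alongLine A x ζ t - alongLine A x ζ (-t) - 2 * ∑ n ∈ Finset.range N,
      ((t ^ (2 * n + 1) / (2 * n + 1).factorial : ℝ) : ℂ) *
        iteratedDeriv (2 * n + 1) (alongLine A x ζ) 0) *
      (𝓕 (B : PhaseSpace d → ℂ) ζ * planeWave ζ x) := by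
  have hE : ∀ t : ℝ, Integrable fun ζ => alongLine A x ζ t *
      (𝓕 (B : PhaseSpace d → ℂ) ζ * planeWave ζ x) := fun t => by
    simpa only [iteratedDeriv_zero] using alongLine_iteratedDeriv_integrable hA B x 0 t
  have hm : ∀ n ∈ Finset.range N, Integrable fun ζ =>
      ((t ^ (2 * n + 1) / (2 * n + 1).factorial : ℝ) : ℂ) *
        (iteratedDeriv (2 * n + 1) (alongLine A x ζ) 0 *
          (𝓕 (B : PhaseSpace d → ℂ) ζ * planeWave ζ x)) := fun n _ =>
    (alongLine_iteratedDeriv_integrable hA B x (2 * n + 1) 0).const_mul _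
  have hS : 2 * ∑ n ∈ Finset.range N, ((t ^ (2 * n + 1) / (2 * n + 1).factorial : ℝ) : ℂ) *
        (Complex.I ^ (2 * n + 1) * poissonPow (2 * n + 1) A B x) =
      ∫ ζ, 2 * ∑ n ∈ Finset.range N, ((t ^ (2 * n + 1) / (2 * n + 1).factorial : ℝ) : ℂ) *
        (iteratedDeriv (2 * n + 1) (alongLine A x ζ) 0 *
          (𝓕 (B : PhaseSpace d → ℂ) ζ * planeWave ζ x)) := by
    rw [integral_const_mul, integral_finsetSum _ hm]
    congr 1
    refine Finset.sum_congr rfl fun n _ => ?_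
    rw [integral_const_mul, integral_iteratedDeriv_alongLine hA]
  have hE' : ∀ t : ℝ, expPoisson t A B x = ∫ ζ, alongLine A x ζ t *
      (𝓕 (B : PhaseSpace d → ℂ) ζ * planeWave ζ x) := fun t => rfl
  rw [hS, hE', hE', ← integral_sub (hE t) (hE (-t)), ← integral_sub]
  rotate_left
  · exact (hE t).sub (hE (-t))
  · exact (integrable_finsetSum _ hm).const_mul 2
  congr 1
  ext ζ
  rw [sub_mul, sub_mul, mul_assoc, Finset.sum_mul]
  simp only [mul_assoc]

theorem I_pow_odd (n : ℕ) : Complex.I ^ (2 * n + 1) = (-1) ^ n * Complex.I := by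
  rw [pow_succ, pow_mul, Complex.I_sq]

/-- The expansion of the Moyal bracket with a remainder that is uniform in the wavelength, the
Schwartz function, and the point of a compact set. -/
theorem moyalBracket_sub_sum_le {H : PhaseSpace d → ℂ} (hH : H.HasTemperateGrowth)
    {K : Set (PhaseSpace d)} (hK : IsCompact K) {lam₀ : ℝ} (hlam₀ : 0 < lam₀) (N : ℕ) :
    ∃ (C : ℝ) (s : Finset (ℕ × ℕ)), ∀ lam ∈ Set.Ioc 0 lam₀, ∀ (B : 𝓢(PhaseSpace d, ℂ)),
      ∀ x ∈ K, ‖moyalBracket (lam / (2 * Real.pi)) H B x - ∑ n ∈ Finset.range N,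
          (((-1) ^ n / (2 * n + 1).factorial * (lam / (2 * Real.pi) / 2) ^ (2 * n) : ℝ) : ℂ)
            * poissonPow (2 * n + 1) H B x‖
        ≤ C * lam ^ (2 * N) * s.sup (schwartzSeminormFamily ℝ (PhaseSpace d) ℂ) B := by
  obtain ⟨R, hR0, hR⟩ := hK.isBounded.exists_pos_norm_le
  obtain ⟨C, k, hC0, hC⟩ := alongLine_iteratedDeriv_bound hH (2 * N + 1) hR0.le hlam₀.le
  obtain ⟨M, s, hM0, hM⟩ := integral_one_add_norm_pow_mul_fourier_le (d := d) k
  refine ⟨C * M, s, fun lam hlam B x hx => ?_⟩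
  have hl : 0 < lam := hlam.1
  set t : ℝ := lam / (2 * Real.pi) / 2 with ht
  have ht0 : 0 < t := by positivity
  -- Here `t = lam / (4π)`. The bound keeps `t` in the range `|t| ≤ lam₀` and finally turns `t ^
  -- (2N)` into `lam ^ (2N)`.
  have htl : t ≤ lam := by
    rw [ht, div_div]
    refine div_le_self hl.le ?_
    linarith [Real.pi_gt_three]
  have hrem : ‖expPoisson t H B x - expPoisson (-t) H B x - 2 * ∑ n ∈ Finset.range N,
      ((t ^ (2 * n + 1) / (2 * n + 1).factorial : ℝ) : ℂ) *
        (Complex.I ^ (2 * n + 1) * poissonPow (2 * n + 1) H B x)‖ ≤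
      2 * C * t ^ (2 * N + 1) *
        (M * s.sup (schwartzSeminormFamily ℝ (PhaseSpace d) ℂ) B) := by
    rw [expPoisson_sub_expPoisson_neg hH]
    refine (norm_integral_le_of_norm_le (((hM B).1).const_mul (2 * C * t ^ (2 * N + 1)))
      (Filter.Eventually.of_forall fun ζ => ?_)).trans ?_
    · rw [norm_mul, norm_mul, planeWave_norm, mul_one, ← mul_assoc]
      refine mul_le_mul_of_nonneg_right ?_ (norm_nonneg _)
      refine (norm_odd_part_sub_taylor_le (alongLine_contDiff hH.1 x ζ) N ht0
        (fun r hr => hC x (hR x hx) ζ r (hr.trans (htl.trans hlam.2)))).trans (le_of_eq ?_)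
      ring
    · rw [integral_const_mul]
      exact mul_le_mul_of_nonneg_left (hM B).2 (by positivity)
  have hbar : (2 / (lam / (2 * Real.pi)) : ℝ) = t⁻¹ := by rw [ht, inv_div]
  have htC : (t : ℂ) ≠ 0 := by exact_mod_cast ht0.ne'
  have heq : moyalBracket (lam / (2 * Real.pi)) H B x - ∑ n ∈ Finset.range N,
      (((-1) ^ n / (2 * n + 1).factorial * t ^ (2 * n) : ℝ) : ℂ) * poissonPow (2 * n + 1) H B x =
      (2 * t * Complex.I)⁻¹ * (expPoisson t H B x - expPoisson (-t) H B x -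
        2 * ∑ n ∈ Finset.range N, ((t ^ (2 * n + 1) / (2 * n + 1).factorial : ℝ) : ℂ) *
        (Complex.I ^ (2 * n + 1) * poissonPow (2 * n + 1) H B x)) := by
    rw [moyalBracket, sinPoisson, hbar, ← ht, mul_sub]
    congr 1
    · push_cast
      field_simp
    · rw [Finset.mul_sum, Finset.mul_sum]
      refine Finset.sum_congr rfl fun n _ => ?_
      rw [I_pow_odd]
      push_cast
      field_simp
      ring
  rw [heq, norm_mul, norm_inv, norm_mul, norm_mul, Complex.norm_I, Complex.norm_real,
    Real.norm_of_nonneg ht0.le, mul_one, Complex.norm_ofNat]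
  calc (2 * t)⁻¹ * _ ≤ (2 * t)⁻¹ * (2 * C * t ^ (2 * N + 1) *
        (M * s.sup (schwartzSeminormFamily ℝ (PhaseSpace d) ℂ) B)) := by gcongr
    _ = C * M * t ^ (2 * N) * s.sup (schwartzSeminormFamily ℝ (PhaseSpace d) ℂ) B := by
        field_simp
        ring
    _ ≤ _ := by gcongr

/-! ### Explicit forms of `Λ` and `Λ³`, and the theorem. -/

theorem poissonPow_one (A B : PhaseSpace d → ℂ) (x : PhaseSpace d) :
    poissonPow 1 A B x = poissonBracket A B x := rfl

/-- The cube of a difference has eight terms. Symmetry of mixed partials puts position derivatives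
outermost, and renaming summation indices merges the terms with binomial weights `1, 3, 3, 1`. -/
theorem poissonPow_three {A B : PhaseSpace d → ℂ} (hA : ContDiff ℝ (⊤ : ℕ∞) A)
    (hB : ContDiff ℝ (⊤ : ℕ∞) B) (x : PhaseSpace d) :
    poissonPow 3 A B x = thirdOrder A B x := by
  have hrp : ∀ {F : PhaseSpace d → ℂ}, ContDiff ℝ (⊤ : ℕ∞) F → ∀ i j,
      dp i (dr j F) = dr j (dp i F) := fun hF i j =>
    partialDeriv_comm hF (Sum.inr i) (Sum.inl j)
  have hr : ∀ {F : PhaseSpace d → ℂ}, ContDiff ℝ (⊤ : ℕ∞) F → ∀ i,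
      ContDiff ℝ (⊤ : ℕ∞) (dr i F) := fun hF i => partialDeriv_contDiff hF (Sum.inl i)
  have hp : ∀ {F : PhaseSpace d → ℂ}, ContDiff ℝ (⊤ : ℕ∞) F → ∀ i,
      ContDiff ℝ (⊤ : ℕ∞) (dp i F) := fun hF i => partialDeriv_contDiff hF (Sum.inr i)
  have swap₁₃ : ∀ X : Fin d → Fin d → Fin d → ℂ,
      ∑ i, ∑ j, ∑ k, X i j k = ∑ i, ∑ j, ∑ k, X k j i := fun X => by
    rw [Finset.sum_comm, Finset.sum_congr rfl fun j _ => Finset.sum_comm, Finset.sum_comm]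
  have swap₁₂ : ∀ X : Fin d → Fin d → Fin d → ℂ,
      ∑ i, ∑ j, ∑ k, X i j k = ∑ i, ∑ j, ∑ k, X j i k := fun X => Finset.sum_comm
  have swap₂₃ : ∀ X : Fin d → Fin d → Fin d → ℂ,
      ∑ i, ∑ j, ∑ k, X i j k = ∑ i, ∑ j, ∑ k, X i k j := fun X =>
    Finset.sum_congr rfl fun i _ => Finset.sum_comm
  let P : Fin d → Fin d → Fin d → ℂ := fun i j k =>
    dr i (dr j (dp k A)) x * dp i (dp j (dr k B)) x
  let Q : Fin d → Fin d → Fin d → ℂ := fun i j k =>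
    dr i (dp j (dp k A)) x * dp i (dr j (dr k B)) x
  -- The recursion of `poissonPow` puts the first summation index innermost, hence the order `k j
  -- i`; `P` and `Q` each occur with three index permutations.
  have hl : poissonPow 3 A B x = ∑ i, ∑ j, ∑ k,
      (dr k (dr j (dr i A)) x * dp k (dp j (dp i B)) x
        - (P k j i + P k i j + P j i k) + (Q k j i + Q j k i + Q i k j)
        - dp k (dp j (dp i A)) x * dr k (dr j (dr i B)) x) := by
    simp only [poissonPow, ← Finset.sum_sub_distrib]
    refine Finset.sum_congr rfl fun i _ => Finset.sum_congr rfl fun j _ =>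
      Finset.sum_congr rfl fun k _ => ?_
    simp only [P, Q, hrp hA, hrp hB, hrp (hr hA _), hrp (hr hB _), hrp (hp hA _), hrp (hp hB _)]
    ring
  have hr : thirdOrder A B x = ∑ i, ∑ j, ∑ k,
      (dr i (dr j (dr k A)) x * dp i (dp j (dp k B)) x - 3 * P i j k + 3 * Q i j k
        - dp i (dp j (dp k A)) x * dr i (dr j (dr k B)) x) := rfl
  rw [hl, hr]
  clear_value P Q
  simp only [Finset.sum_add_distrib, Finset.sum_sub_distrib, ← Finset.mul_sum]
  rw [swap₁₃ fun i j k => dr k (dr j (dr i A)) x * dp k (dp j (dp i B)) x,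
    swap₁₃ fun i j k => dp k (dp j (dp i A)) x * dr k (dr j (dr i B)) x,
    swap₁₂ fun i j k => P k i j, swap₁₃ fun i j k => P k j i, swap₁₂ fun i j k => P j i k,
    swap₂₃ fun i j k => Q j k i, swap₁₃ fun i j k => Q k j i, swap₂₃ fun i j k => Q i k j]
  ring

end WignerMoyal

open WignerMoyal in
theorem mainTheorem5 (d : ℕ) (H : PhaseSpace d → ℂ) (hH : Function.HasTemperateGrowth H)
    (K : Set (PhaseSpace d)) (hK : IsCompact K) (lam₀ : ℝ) (hlam₀ : 0 < lam₀) :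
    (∀ N : ℕ, ∃ (C : ℝ) (s : Finset (ℕ × ℕ)),
      ∀ lam ∈ Set.Ioc 0 lam₀, ∀ (W : ℝ → 𝓢(PhaseSpace d, ℂ)) (z : ℝ), ∀ x ∈ K,
        WignerMoyalEquationAt lam H W z x →
          ‖deriv (fun z' => W z' x) z
              - ∑ n ∈ Finset.range N,
                  (((-1) ^ n / (2 * n + 1).factorial * (lam / (2 * Real.pi) / 2) ^ (2 * n) : ℝ) : ℂ)
                    * poissonPow (2 * n + 1) H (W z) x‖
            ≤ C * lam ^ (2 * N) * s.sup (schwartzSeminormFamily ℝ (PhaseSpace d) ℂ) (W z))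
    ∧ (∃ (C : ℝ) (s : Finset (ℕ × ℕ)),
      ∀ lam ∈ Set.Ioc 0 lam₀, ∀ (W : ℝ → 𝓢(PhaseSpace d, ℂ)) (z : ℝ), ∀ x ∈ K,
        WignerMoyalEquationAt lam H W z x →
          ‖deriv (fun z' => W z' x) z
              - (poissonBracket H (W z) x
                  - (((lam / (2 * Real.pi)) ^ 2 / 24 : ℝ) : ℂ) * thirdOrder H (W z) x)‖
            ≤ C * lam ^ 4 * s.sup (schwartzSeminormFamily ℝ (PhaseSpace d) ℂ) (W z))
    ∧ ((∀ i j k x, dr i (dr j (dp k H)) x = 0 ∧ dr i (dp j (dp k H)) x = 0 ∧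
          dp i (dp j (dp k H)) x = 0) →
      ∃ (C : ℝ) (s : Finset (ℕ × ℕ)),
      ∀ lam ∈ Set.Ioc 0 lam₀, ∀ (W : ℝ → 𝓢(PhaseSpace d, ℂ)) (z : ℝ), ∀ x ∈ K,
        WignerMoyalEquationAt lam H W z x →
          ‖deriv (fun z' => W z' x) z
              - (poissonBracket H (W z) x
                  - (((lam / (2 * Real.pi)) ^ 2 / 24 : ℝ) : ℂ) *
                    ∑ i, ∑ j, ∑ k,
                      dr i (dr j (dr k H)) x * dp i (dp j (dp k (W z))) x)‖
            ≤ C * lam ^ 4 * s.sup (schwartzSeminormFamily ℝ (PhaseSpace d) ℂ) (W z)) := by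
  have key : ∀ N : ℕ, ∃ (C : ℝ) (s : Finset (ℕ × ℕ)),
      ∀ lam ∈ Set.Ioc 0 lam₀, ∀ (W : ℝ → 𝓢(PhaseSpace d, ℂ)) (z : ℝ), ∀ x ∈ K,
        WignerMoyalEquationAt lam H W z x →
          ‖deriv (fun z' => W z' x) z
              - ∑ n ∈ Finset.range N,
                  (((-1) ^ n / (2 * n + 1).factorial * (lam / (2 * Real.pi) / 2) ^ (2 * n) : ℝ) : ℂ)
                    * poissonPow (2 * n + 1) H (W z) x‖
            ≤ C * lam ^ (2 * N) * s.sup (schwartzSeminormFamily ℝ (PhaseSpace d) ℂ) (W z) := by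
    intro N
    obtain ⟨C, s, h⟩ := moyalBracket_sub_sum_le hH hK hlam₀ N
    refine ⟨C, s, fun lam hlam W z x hx hW => ?_⟩
    rw [HasDerivAt.deriv hW]
    exact h lam hlam (W z) x hx
  have third : ∃ (C : ℝ) (s : Finset (ℕ × ℕ)),
      ∀ lam ∈ Set.Ioc 0 lam₀, ∀ (W : ℝ → 𝓢(PhaseSpace d, ℂ)) (z : ℝ), ∀ x ∈ K,
        WignerMoyalEquationAt lam H W z x →
          ‖deriv (fun z' => W z' x) z
              - (poissonBracket H (W z) x
                  - (((lam / (2 * Real.pi)) ^ 2 / 24 : ℝ) : ℂ) * thirdOrder H (W z) x)‖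
            ≤ C * lam ^ 4 * s.sup (schwartzSeminormFamily ℝ (PhaseSpace d) ℂ) (W z) := by
    obtain ⟨C, s, h⟩ := key 2
    refine ⟨C, s, fun lam hlam W z x hx hW => ?_⟩
    -- The coefficient for `n = 1` is `-(ƛ/2)²/3! = -ƛ²/24`.
    refine le_trans (le_of_eq ?_) (h lam hlam W z x hx hW)
    congr 2
    rw [Finset.sum_range_succ, Finset.sum_range_one, mul_zero, zero_add, mul_one,
      show 2 + 1 = 3 from rfl, poissonPow_one, poissonPow_three hH.1 ((W z).smooth ⊤),
      show Nat.factorial 3 = 6 from rfl, Nat.factorial_one]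
    push_cast
    ring
  refine ⟨key, third, fun hzero => ?_⟩
  obtain ⟨C, s, h⟩ := third
  refine ⟨C, s, fun lam hlam W z x hx hW => ?_⟩
  have hT : thirdOrder H (W z) x =
      ∑ i, ∑ j, ∑ k, dr i (dr j (dr k H)) x * dp i (dp j (dp k (W z))) x := by
    refine Finset.sum_congr rfl fun i _ => Finset.sum_congr rfl fun j _ =>
      Finset.sum_congr rfl fun k _ => ?_
    -- The assumed vanishing derivatives have exactly the orderings occurring in `thirdOrder`, so no
    -- symmetry is needed.
    rw [(hzero i j k x).1, (hzero i j k x).2.1, (hzero i j k x).2.2]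
    ring
  rw [← hT]
  exact h lam hlam W z x hx hW
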